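/- Let $G$ be a countable (finite or countably infinite) abelian group, viewed as a first-order structure in the signature $\{+,-,0\}$, and suppose that $G$ is $\omega$-categorical, i.e. all countably infinite models of the complete first-order theory of $G$ are isomorphic. Let $(G,\neq)$ be the expansion of $G$ by the binary disequality relation, and suppose that $(G,\neq)$ has a pseudo-Siggers polymorphism, i.e. there are a map $s\colon G^6\to G$ that preserves all operations and relations of $(G,\neq)$ (equivalently, $s$ is a group homomorphism such that $s(a)\neq s(b)$ whenever $a_i\neq b_i$ for all $i\in\{1,\dots,6\}$) and endomorphisms $e_1,e_2$ of $(G,\neq)$ such that $$e_1\big(s(x,y,x,z,y,z)\big)=e_2\big(s(y,x,z,x,z,y)\big)\qquad\text{for all } x,y,z\in G.$$ Then there is an integer $m\geq 1$ such that $G$ is bi-embeddable with $\mathbb{Z}_m^{(\omega)}$ or with $\mathbb{Z}_m^{(\omega)}\oplus\mathbb{Z}_{2m}$. Here $\mathbb{Z}_m^{(\omega)}$ is the direct sum of countably infinitely many copies of the cyclic group $\mathbb{Z}_m$ of order $m$, and two groups are bi-embeddable if each of them is isomorphic to a subgroup of the other. -/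

import Mathlib

open scoped FirstOrder

namespace PseudoSiggers

universe u v w

/-- The function symbols `+`, `-`, `0` of abelian groups in additive notation. -/
inductive GroupFunc : ℕ → Type
  | zero : GroupFunc 0
  | neg : GroupFunc 1
  | add : GroupFunc 2

/-- The first-order language of abelian groups; it is purely functional. -/
def groupLang : FirstOrder.Language.{0, 0} where
  Functions := GroupFunc
  Relations := fun _ => Empty

/-- An abelian group as a first-order structure. -/
instance groupStructure (G : Type w) [AddCommGroup G] : groupLang.Structure G where
  funMap {_} g :=
    match g with
    | .zero => fun _ => 0
    | .neg => fun x => - x 0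
    | .add => fun x => x 0 + x 1
  RelMap {_} r := nomatch r

/-- A single binary relation symbol. -/
inductive NeqRel : ℕ → Type
  | neq : NeqRel 2

/-- The language whose only symbol is the binary relation symbol for disequality. -/
def neqLang : FirstOrder.Language.{0, 0} where
  Functions := fun _ => Empty
  Relations := NeqRel

/-- The symbol of `neqLang` denotes the relation `≠` on every set. -/
instance neqStructure (A : Type w) : neqLang.Structure A where
  funMap {_} g := nomatch g
  RelMap {_} r :=
    match r with
    | .neq => fun x => x 0 ≠ x 1

/-- A structure is `ω`-categorical if all countably infinite models of its complete first-order
theory are isomorphic. -/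
def IsOmegaCategorical (L : FirstOrder.Language.{u, v}) (A : Type w) [L.Structure A] : Prop :=
  Cardinal.Categorical.{u, v, 0} Cardinal.aleph0 (L.completeTheory A)

/-- A `k`-ary operation is a polymorphism of a structure if it preserves (that is, commutes with)
all operations and preserves all relations of the structure. -/
structure IsPolymorphism (L : FirstOrder.Language.{u, v}) {A : Type w} [L.Structure A] {k : ℕ}
    (f : (Fin k → A) → A) : Prop where
  map_fun : ∀ {m : ℕ} (g : L.Functions m) (a : Fin m → Fin k → A),
    f (fun j => FirstOrder.Language.Structure.funMap g (fun i => a i j)) =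
      FirstOrder.Language.Structure.funMap g (fun i => f (a i))
  map_rel : ∀ {m : ℕ} (R : L.Relations m) (a : Fin m → Fin k → A),
    (∀ j, FirstOrder.Language.Structure.RelMap R (fun i => a i j)) →
      FirstOrder.Language.Structure.RelMap R (fun i => f (a i))

/-- The structure has a pseudo-Siggers polymorphism: a polymorphism `s` of arity six such that
`e₁ (s(x,y,x,z,y,z)) = e₂ (s(y,x,z,x,z,y))` for some endomorphisms `e₁`, `e₂`. -/
def HasPseudoSiggers (L : FirstOrder.Language.{u, v}) (A : Type w) [L.Structure A] : Prop :=
  ∃ s : (Fin 6 → A) → A, IsPolymorphism L s ∧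
    ∃ e₁ e₂ : A →[L] A, ∀ x y z : A, e₁ (s ![x, y, x, z, y, z]) = e₂ (s ![y, x, z, x, z, y])

/-- Each of the two abelian groups embeds into the other one. -/
def BiEmbeddable (G : Type u) (H : Type v) [AddCommGroup G] [AddCommGroup H] : Prop :=
  (∃ f : G →+ H, Function.Injective f) ∧ (∃ g : H →+ G, Function.Injective g)

end PseudoSiggers

/-! Categoricity bounds the exponent. By the Ryll-Nardzewski argument, an infinite `G` has only
finitely many parameter-free definable sets of pairs, so the graphs of `x ↦ k • x` and `x ↦ l • x`
coincide for some `k < l`, and `l - k` annihilates `G`. Hence the `k` with `k • G` finite are the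
multiples of some `m ≥ 1`.

The pseudo-Siggers identity shows that the finite group `F = m • G` has at most two elements. All
the maps are homomorphisms and so restrict to `F`. If `F` had two nonzero elements, preservation of
`≠` would force `s` on `F` to depend on one coordinate `j` only, injectively
(`eq_of_ne_zero_of_siggers`). The two tuples of the identity carry different variables at every
position, which is then contradictory.

If `F = 0`, characters embed `G` into `ZMod m`-valued finitely supported functions. If `F = {0, f}`,
the same is done for `G ⧸ F`, and one character to `ZMod (2 * m)` that is nonzero at `f` restores
injectivity. Conversely, minimality of `m` provides, modulo any finite subgroup, an element of order
`m` annihilated by `m` (`exists_nsmul_mem_imp_dvd`). Iteration gives infinitely many independent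
copies of `ZMod m`, in the second case also independent of a cyclic subgroup of order `2 * m`. -/

namespace PseudoSiggers

open FirstOrder FirstOrder.Language Cardinal Set

/-! ### Compactness and isolated types -/

section RyllNardzewski

variable {L : FirstOrder.Language.{0, 0}} {M : Type} [L.Structure M]

/-- In an `ω`-categorical countable structure, finitely realizable sets of formulas are realized. -/
theorem exists_realize_of_finitely_realizable (hL : L.card ≤ ℵ₀) [Countable M] [Infinite M]
    (hcat : IsOmegaCategorical L M) {α : Type} [Countable α] (Γ : Set (L.Formula α))
    (h : ∀ Δ : Set (L.Formula α), Δ.Finite → Δ ⊆ Γ → ∃ v : α → M, ∀ φ ∈ Δ, φ.Realize v) :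
    ∃ v : α → M, ∀ φ ∈ Γ, φ.Realize v := by
  classical
  let T' : (L[[α]]).Theory :=
    (L.lhomWithConstants α).onTheory (L.completeTheory M) ∪ Formula.equivSentence '' Γ
  have hsat : T'.IsSatisfiable := by
    rw [Theory.isSatisfiable_iff_isFinitelySatisfiable]
    intro T0 hT0
    obtain ⟨v, hv⟩ := h (Γ ∩ Formula.equivSentence ⁻¹' (T0 : Set _))
      (Set.Finite.inter_of_right
        (T0.finite_toSet.preimage (Formula.equivSentence.injective.injOn)) _)
      inter_subset_left
    let _ := constantsOn.structure v
    have : Theory.Model M (T0 : (L[[α]]).Theory) := by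
      constructor
      intro φ hφ
      rcases hT0 hφ with h1 | ⟨ψ, hψ, rfl⟩
      · have : Theory.Model M ((L.lhomWithConstants α).onTheory (L.completeTheory M)) :=
          (LHom.onTheory_model _ _).2 inferInstance
        exact Theory.realize_sentence_of_mem _ h1
      · rw [Formula.realize_equivSentence]
        exact hv ψ ⟨hψ, hφ⟩
    exact Theory.Model.isSatisfiable M
  obtain ⟨N0⟩ := hsat
  -- Löwenheim–Skolem needs an infinite model to produce one of cardinality `ℵ₀`.
  have key : Infinite N0 := by
    have h1 : Theory.Model N0 ((L.lhomWithConstants α).onTheory (L.completeTheory M)) :=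
      N0.is_model.mono subset_union_left
    let _ : L.Structure N0 := (L.lhomWithConstants α).reduct N0
    have h2 : Theory.Model N0 (L.completeTheory M) := (LHom.onTheory_model _ _).1 h1
    have h3 : M ≅[L] N0 := elementarilyEquivalent_iff.2 fun φ =>
      (realize_iff_of_model_completeTheory M N0 φ).symm
    exact h3.infinite_iff.1 inferInstance
  obtain ⟨N, hN⟩ := Theory.exists_model_card_eq (T := T') ⟨N0, key⟩ ℵ₀ le_rfl (by
    simpa [card_withConstants] using hL)
  have h1 : Theory.Model N ((L.lhomWithConstants α).onTheory (L.completeTheory M)) :=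
    N.is_model.mono subset_union_left
  let _ : L.Structure N := (L.lhomWithConstants α).reduct N
  have h2 : Theory.Model N (L.completeTheory M) := (LHom.onTheory_model _ _).1 h1
  obtain ⟨e⟩ := hcat (Theory.ModelType.of _ N) (Theory.ModelType.of _ M) hN (mk_eq_aleph0 M)
  refine ⟨fun a => e (L.con a : N), fun φ hφ => ?_⟩
  have h4 : N ⊨ Formula.equivSentence φ :=
    Theory.realize_sentence_of_mem T' (Or.inr ⟨φ, hφ, rfl⟩)
  rw [Formula.realize_equivSentence] at h4
  exact (StrongHomClass.realize_formula e φ).2 h4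

/-- A tuple is isolated if some formula that it satisfies implies its complete type. -/
def IsIsolated (L : FirstOrder.Language.{0, 0}) {M : Type} [L.Structure M] {α : Type}
    (v : α → M) : Prop :=
  ∃ θ : L.Formula α, θ.Realize v ∧
    ∀ χ : L.Formula α, χ.Realize v → ∀ w : α → M, θ.Realize w → χ.Realize w

/-- In an `ω`-categorical countable structure, isolated tuples are dense. -/
theorem exists_isIsolated_of_realize (hL : L.card ≤ ℵ₀) [Countable M] [Infinite M]
    (hcat : IsOmegaCategorical L M) {α : Type} [Finite α] (φ : L.Formula α)
    (hφ : ∃ v : α → M, φ.Realize v) : ∃ v : α → M, φ.Realize v ∧ IsIsolated L v := by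
  by_contra! hcon
  obtain ⟨g, hg⟩ := exists_surjective_nat (α → M)
  have step : ∀ (k : ℕ) (ψ : {ψ : L.Formula α // (∃ v : α → M, ψ.Realize v) ∧
      ∀ v : α → M, ψ.Realize v → φ.Realize v}),
      ∃ ψ' : {ψ : L.Formula α // (∃ v : α → M, ψ.Realize v) ∧
        ∀ v : α → M, ψ.Realize v → φ.Realize v},
        (∀ v : α → M, ψ'.1.Realize v → ψ.1.Realize v) ∧ ¬ ψ'.1.Realize (g k) := by
    rintro k ⟨ψ, ⟨v, hv⟩, hψ⟩
    have h1 : ∃ χ : L.Formula α, χ.Realize v ∧ ∃ w : α → M, ψ.Realize w ∧ ¬ χ.Realize w := by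
      by_contra! h2
      exact hcon v (hψ v hv) ⟨ψ, hv, h2⟩
    obtain ⟨χ, hχ, w, hw, hχw⟩ := h1
    -- `χ` splits `ψ` into two satisfiable halves; the one that excludes `g k` is kept. The limit of
    -- these choices is finitely realizable but omits every tuple.
    by_cases hk : χ.Realize (g k)
    · exact ⟨⟨ψ ⊓ χ.not, ⟨w, by simp [hw, hχw]⟩, fun u hu => hψ u (by simp at hu; exact hu.1)⟩,
        fun u hu => by simp at hu; exact hu.1, by simp [hk]⟩
    · exact ⟨⟨ψ ⊓ χ, ⟨v, by simp [hv, hχ]⟩, fun u hu => hψ u (by simp at hu; exact hu.1)⟩,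
        fun u hu => by simp at hu; exact hu.1, by simp [hk]⟩
  choose next hnext1 hnext2 using step
  let s : ℕ → {ψ : L.Formula α // (∃ v : α → M, ψ.Realize v) ∧
      ∀ v : α → M, ψ.Realize v → φ.Realize v} :=
    fun n => Nat.rec ⟨φ, hφ, fun _ h => h⟩ next n
  have hs : ∀ n, s (n + 1) = next n (s n) := fun _ => rfl
  have hanti : ∀ m n, m ≤ n → ∀ v : α → M, (s n).1.Realize v → (s m).1.Realize v := by
    intro m n hmn
    induction hmn with
    | refl => exact fun _ h => h
    | step _ ih => exact fun v hv => ih v (hnext1 _ _ v (by rw [← hs]; exact hv))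
  obtain ⟨v, hv⟩ := exists_realize_of_finitely_realizable hL hcat (range fun n => (s n).1) (by
    intro Δ hΔ hsub
    obtain ⟨t, ht⟩ : ∃ t : Set ℕ, t.Finite ∧ Δ = (fun n => (s n).1) '' t := by
      obtain ⟨t, -, ht, h⟩ := exists_subset_image_finite_and (s := univ) (f := fun n => (s n).1)
        (p := fun u => u = Δ) |>.1 ⟨Δ, by simpa using hsub, hΔ, rfl⟩
      exact ⟨t, ht, h.symm⟩
    obtain ⟨b, hb⟩ := ht.1.bddAbove
    obtain ⟨v, hv⟩ := (s b).2.1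
    refine ⟨v, fun ψ hψ => ?_⟩
    rw [ht.2] at hψ
    obtain ⟨n, hn, rfl⟩ := hψ
    exact hanti n b (hb hn) v hv)
  obtain ⟨k, rfl⟩ := hg v
  have := hv _ ⟨k + 1, rfl⟩
  exact hnext2 k (s k) this

/-- The image of the isolating set under a coordinate map is again definable, by existential
quantification, and its formula isolates the new tuple. -/
theorem IsIsolated.comp {α β : Type} [Finite α] [Finite β] {v : β → M} (h : IsIsolated L v)
    (f : α → β) : IsIsolated L (v ∘ f) := by
  obtain ⟨θ, hθ, hiso⟩ := h
  have hdef : (∅ : Set M).Definable L (Set.image (fun g : β → M => g ∘ f) {w | θ.Realize w}) :=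
    (Set.empty_definable_iff.2 ⟨θ, rfl⟩).image_comp f
  obtain ⟨θ', hθ'⟩ := Set.empty_definable_iff.1 hdef
  refine ⟨θ', ?_, ?_⟩
  · have : v ∘ f ∈ Set.image (fun g : β → M => g ∘ f) {w | θ.Realize w} := ⟨v, hθ, rfl⟩
    rwa [hθ'] at this
  · intro χ hχ w hw
    have : w ∈ Set.image (fun g : β → M => g ∘ f) {w | θ.Realize w} := by rwa [hθ']
    obtain ⟨w', hw', rfl⟩ := this
    have := hiso (χ.relabel f) (Formula.realize_relabel.2 hχ) w' hw'
    exact Formula.realize_relabel.1 this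

/-- Isolated tuples extend to isolated tuples with a prescribed property of the new entry. -/
theorem IsIsolated.exists_snoc (hL : L.card ≤ ℵ₀) [Countable M] [Infinite M]
    (hcat : IsOmegaCategorical L M) {n : ℕ} {v : Fin n → M} (h : IsIsolated L v)
    (φ : L.Formula (Fin (n + 1)))
    (hφ : ∃ a : M, φ.Realize (Fin.snoc v a : Fin (n + 1) → M)) :
    ∃ a : M, φ.Realize (Fin.snoc v a : Fin (n + 1) → M) ∧
      IsIsolated L (Fin.snoc v a : Fin (n + 1) → M) := by
  obtain ⟨θ, hθ, hiso⟩ := h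
  obtain ⟨a, ha⟩ := hφ
  obtain ⟨w, hw, ψ, hψ, hisoψ⟩ := exists_isIsolated_of_realize hL hcat
    (φ ⊓ θ.relabel Fin.castSucc) ⟨Fin.snoc v a, by
      have : (Fin.snoc v a : Fin (n + 1) → M) ∘ Fin.castSucc = v := by ext i; simp
      simp [ha, Formula.realize_relabel, this, hθ]⟩
  have hdef : (∅ : Set M).Definable L
      (Set.image (fun g : Fin (n + 1) → M => g ∘ Fin.castSucc) {w | ψ.Realize w}) :=
    (Set.empty_definable_iff.2 ⟨ψ, rfl⟩).image_comp Fin.castSucc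
  obtain ⟨ψ', hψ'⟩ := Set.empty_definable_iff.1 hdef
  have hwθ : θ.Realize (w ∘ Fin.castSucc) := by
    simp [Formula.realize_relabel] at hw; exact hw.2
  -- Otherwise the negation of `ψ'` would belong to the type of `v` and follow from `θ`, but the
  -- restriction of `w` satisfies both `θ` and `ψ'`.
  have hv : v ∈ Set.image (fun g : Fin (n + 1) → M => g ∘ Fin.castSucc) {w | ψ.Realize w} := by
    by_contra hcon
    rw [hψ'] at hcon
    have h1 : (ψ'.not).Realize v := by simpa using hcon
    have h2 := hiso _ h1 _ hwθ
    have h3 : w ∘ Fin.castSucc ∈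
      Set.image (fun g : Fin (n + 1) → M => g ∘ Fin.castSucc) {w | ψ.Realize w} := ⟨w, hψ, rfl⟩
    rw [hψ'] at h3
    simp at h2
    exact h2 h3
  obtain ⟨u, hu, rfl⟩ := hv
  refine ⟨u (Fin.last n), ?_⟩
  have hsn : (Fin.snoc (u ∘ Fin.castSucc) (u (Fin.last n)) : Fin (n + 1) → M) = u :=
    Fin.snoc_init_self u
  rw [show (fun g : Fin (n + 1) → M => g ∘ Fin.castSucc) u = u ∘ Fin.castSucc from rfl, hsn]
  have h1 := hisoψ _ hw u hu
  simp at h1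
  refine ⟨h1.1, ψ, hu, fun χ hχ x hx => ?_⟩
  refine hisoψ χ ?_ x hx
  by_contra hc
  have := hisoψ χ.not (by simpa using hc) u hu
  simp at this
  exact this hχ

end RyllNardzewski
end PseudoSiggers

namespace PseudoSiggers

open FirstOrder FirstOrder.Language Cardinal Set

/-! ### Atomicity and finiteness of the definable sets -/

section RyllNardzewski

variable {L : FirstOrder.Language.{0, 0}} {M : Type} [L.Structure M]

theorem countable_boundedFormula_empty (hL : L.card ≤ ℵ₀) :
    Countable (Σ n, L.BoundedFormula Empty n) := by
  refine mk_le_aleph0_iff.mp (BoundedFormula.card_le.trans (max_le le_rfl ?_))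
  simpa using hL

/-- A countable `ω`-categorical structure contains a sequence whose finite subtuples are isolated
and whose range satisfies the Tarski–Vaught criterion. -/
theorem exists_isolated_sequence (hL : L.card ≤ ℵ₀) [Countable M] [Infinite M]
    (hcat : IsOmegaCategorical L M) :
    ∃ b : ℕ → M, (∀ k, IsIsolated L (fun i : Fin k => b i)) ∧
      ∀ (n : ℕ) (φ : L.BoundedFormula Empty (n + 1)) (j : Fin n → ℕ) (a : M),
        φ.Realize default (Fin.snoc (b ∘ j) a : Fin (n + 1) → M) →
          ∃ k, φ.Realize default (Fin.snoc (b ∘ j) (b k) : Fin (n + 1) → M) := by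
  classical
  have hc := countable_boundedFormula_empty hL
  let T := Σ n : ℕ, L.BoundedFormula Empty (n + 1) × (Fin n → ℕ)
  have hcT : Countable T := by
    have : ∀ n : ℕ, Countable (L.BoundedFormula Empty (n + 1)) := fun n =>
      Function.Injective.countable
        (f := fun φ => (⟨n + 1, φ⟩ : Σ n, L.BoundedFormula Empty n)) sigma_mk_injective
    infer_instance
  have : Nonempty T := ⟨⟨0, ⊤, Fin.elim0⟩⟩
  obtain ⟨e, he⟩ := exists_surjective_nat T
  -- `Fin.last k` is a dummy value for parameters not yet constructed at stage `k`.
  let form : ∀ (k : ℕ) (t : T), L.Formula (Fin (k + 1)) := fun k t =>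
    t.2.1.toFormula.relabel (Sum.elim Empty.elim (Fin.snoc
      (fun i => if h : t.2.2 i < k then Fin.castSucc ⟨t.2.2 i, h⟩ else Fin.last k)
      (Fin.last k) : Fin (t.1 + 1) → Fin (k + 1)))
  have step : ∀ (k : ℕ) (v : {v : Fin k → M // IsIsolated L v}),
      ∃ a : M, IsIsolated L (Fin.snoc v.1 a : Fin (k + 1) → M) ∧
        ((∃ a', (form k (e k.unpair.1)).Realize (Fin.snoc v.1 a' : Fin (k + 1) → M)) →
          (form k (e k.unpair.1)).Realize (Fin.snoc v.1 a : Fin (k + 1) → M)) := by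
    intro k v
    by_cases h : ∃ a', (form k (e k.unpair.1)).Realize (Fin.snoc v.1 a' : Fin (k + 1) → M)
    · obtain ⟨a, h1, h2⟩ := v.2.exists_snoc hL hcat _ h
      exact ⟨a, h2, fun _ => h1⟩
    · obtain ⟨a, -, h2⟩ := v.2.exists_snoc hL hcat ⊤ ⟨Classical.arbitrary M, by simp⟩
      exact ⟨a, h2, fun h' => absurd h' h⟩
  choose next hn1 hn2 using step
  obtain ⟨v0, -, hv0⟩ := exists_isIsolated_of_realize hL hcat (⊤ : L.Formula (Fin 0))
    ⟨Fin.elim0, by simp⟩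
  let st : ∀ k, {v : Fin k → M // IsIsolated L v} := fun k =>
    Nat.rec ⟨v0, hv0⟩ (fun k v => ⟨Fin.snoc v.1 (next k v), hn1 k v⟩) k
  let b : ℕ → M := fun k => next k (st k)
  have hst : ∀ k, (st k).1 = fun i : Fin k => b i := by
    intro k
    induction k with
    | zero => ext i; exact i.elim0
    | succ k ih =>
      ext i
      change (Fin.snoc (st k).1 (next k (st k)) : Fin (k + 1) → M) i = _
      induction i using Fin.lastCases with
      | last => simp [b]
      | cast i => simp [ih]
  refine ⟨b, fun k => hst k ▸ (st k).2, fun n φ j a ha => ?_⟩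
  obtain ⟨i, hi⟩ := he ⟨n, φ, j⟩
  obtain ⟨N, hN⟩ := (Set.finite_range j).bddAbove
  -- Task `i` recurs at every stage `Nat.pair i r`; with `r = N + 1` the stage lies beyond all
  -- parameters `j l`.
  let k := Nat.pair i (N + 1)
  have hk : ∀ l, j l < k := fun l =>
    lt_of_lt_of_le (Nat.lt_succ_of_le (hN ⟨l, rfl⟩)) (Nat.right_le_pair _ _)
  have hform : ∀ c : M, (form k (e k.unpair.1)).Realize (Fin.snoc (st k).1 c : Fin (k + 1) → M) ↔
      φ.Realize default (Fin.snoc (b ∘ j) c : Fin (n + 1) → M) := by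
    intro c
    have : e k.unpair.1 = ⟨n, φ, j⟩ := by simp [k, hi]
    rw [this]
    simp only [form, Formula.realize_relabel, BoundedFormula.realize_toFormula]
    have h1 : (((Fin.snoc (st k).1 c : Fin (k + 1) → M) ∘ (Sum.elim Empty.elim (Fin.snoc
      (fun i => if h : j i < k then Fin.castSucc ⟨j i, h⟩ else Fin.last k)
      (Fin.last k) : Fin (n + 1) → Fin (k + 1)))) ∘ Sum.inr) =
        (Fin.snoc (b ∘ j) c : Fin (n + 1) → M) := by
      ext l
      induction l using Fin.lastCases with
      | last => simp
      | cast l =>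
        simp only [Function.comp_apply, Sum.elim_inr, Fin.snoc_castSucc, hk, dif_pos, hst]
    rw [h1]
    exact iff_of_eq (congrArg (fun z => φ.Realize z _) (Subsingleton.elim _ _))
  refine ⟨k, (hform _).1 (hn2 k (st k) ⟨a, (hform a).2 ha⟩)⟩

/-- Every finite tuple of a countable `ω`-categorical structure is isolated. -/
theorem isIsolated_of_categorical (hL : L.card ≤ ℵ₀) [Countable M] [Infinite M]
    (hcat : IsOmegaCategorical L M) {α : Type} [Finite α] (w : α → M) : IsIsolated L w := by
  obtain ⟨b, hb, htv⟩ := exists_isolated_sequence hL hcat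
  have htv' : ∀ (n : ℕ) (φ : L.BoundedFormula Empty (n + 1)) (x : Fin n → M) (a : M),
      (∀ i, x i ∈ range b) → φ.Realize default (Fin.snoc x a : Fin (n + 1) → M) →
        ∃ c ∈ range b, φ.Realize default (Fin.snoc x c : Fin (n + 1) → M) := by
    intro n φ x a hx ha
    choose j hj using hx
    obtain rfl : b ∘ j = x := funext hj
    obtain ⟨k, hk⟩ := htv n φ j a ha
    exact ⟨b k, ⟨k, rfl⟩, hk⟩
  let S0 : L.Substructure M :=
    { carrier := range b
      fun_mem := by
        intro n f x hx
        obtain ⟨c, hc, hfc⟩ := htv' n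
          (Term.bdEqual (Term.func f fun i => Term.var (Sum.inr (Fin.castSucc i)))
            (Term.var (Sum.inr (Fin.last n)))) x (Structure.funMap f x) hx
          (by simp [BoundedFormula.realize_bdEqual])
        simp [BoundedFormula.realize_bdEqual] at hfc
        rw [hfc]
        exact hc }
  let S : L.ElementarySubstructure M := S0.toElementarySubstructure (by
    intro n φ x a ha
    obtain ⟨c, hc, h⟩ := htv' n φ _ a (fun i => (x i).2) ha
    exact ⟨⟨c, hc⟩, h⟩)
  have hSinf : Infinite S := S.elementarilyEquivalent.infinite_iff.2 inferInstance
  -- Isolation holds for tuples from the elementary substructure `S`; the isomorphism carries it to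
  -- all tuples of `M`.
  obtain ⟨f⟩ := hcat (Theory.ModelType.of _ S) (Theory.ModelType.of _ M)
    (mk_eq_aleph0 S) (mk_eq_aleph0 M)
  let f' : S ≃[L] M := f
  have hmem : ∀ i, ∃ k, b k = (f'.symm (w i) : M) := fun i => (f'.symm (w i)).2
  choose j hj using hmem
  obtain ⟨N, hN⟩ := (Set.finite_range j).bddAbove
  have hiso : IsIsolated L (fun i => (f'.symm (w i) : M)) := by
    have := (hb (N + 1)).comp (fun i => (⟨j i, Nat.lt_succ_of_le (hN ⟨i, rfl⟩)⟩ : Fin (N + 1)))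
    convert this using 1
    ext i
    exact (hj i).symm
  have htp : ∀ χ : L.Formula α, χ.Realize (fun i => (f'.symm (w i) : M)) ↔ χ.Realize w := by
    intro χ
    have h1 := S.subtype.map_formula χ (fun i => f'.symm (w i))
    have h2 := StrongHomClass.realize_formula f' χ (v := fun i => f'.symm (w i))
    have h3 : (f' ∘ fun i => f'.symm (w i)) = w := by ext i; simp
    rw [h3] at h2
    exact h1.trans h2.symm
  obtain ⟨θ, hθ, h⟩ := hiso
  exact ⟨θ, (htp θ).1 hθ, fun χ hχ u hu => h χ ((htp χ).2 hχ) u hu⟩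

/-- A countable `ω`-categorical structure has only finitely many sets of `α`-tuples that are
definable without parameters. -/
theorem finite_definable_of_categorical (hL : L.card ≤ ℵ₀) [Countable M] [Infinite M]
    (hcat : IsOmegaCategorical L M) {α : Type} [Finite α] :
    {E : Set (α → M) | (∅ : Set M).Definable L E}.Finite := by
  choose θ hθ hiso using fun w : α → M => isIsolated_of_categorical hL hcat w
  -- By compactness finitely many isolating formulas cover all tuples, so a definable set is
  -- determined by its trace on `F`.
  obtain ⟨F, hF, hcov⟩ : ∃ F : Set (α → M), F.Finite ∧ ∀ w, ∃ v ∈ F, (θ v).Realize w := by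
    by_contra! hcon
    obtain ⟨v, hv⟩ := exists_realize_of_finitely_realizable hL hcat
      (range fun w => (θ w).not) (by
        intro Δ hΔ hsub
        obtain ⟨t, -, ht, h⟩ := exists_subset_image_finite_and (s := univ)
          (f := fun w => (θ w).not) (p := fun u => u = Δ) |>.1 ⟨Δ, by simpa using hsub, hΔ, rfl⟩
        obtain ⟨w, hw⟩ := hcon t ht
        refine ⟨w, fun φ hφ => ?_⟩
        rw [← h] at hφ
        obtain ⟨u, hu, rfl⟩ := hφ
        simpa using hw u hu)
    have := hv _ ⟨v, rfl⟩
    simp at this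
    exact this (hθ v)
  refine Set.Finite.of_finite_image (f := fun E => E ∩ F)
    (hF.finite_subsets.subset (by rintro _ ⟨E, -, rfl⟩; exact inter_subset_right)) ?_
  have key : ∀ E E' : Set (α → M), (∅ : Set M).Definable L E → (∅ : Set M).Definable L E' →
      E ∩ F = E' ∩ F → E ⊆ E' := by
    intro E E' hE hE' h w hw
    obtain ⟨φ, rfl⟩ := Set.empty_definable_iff.1 hE
    obtain ⟨φ', rfl⟩ := Set.empty_definable_iff.1 hE'
    obtain ⟨v, hvF, hvw⟩ := hcov w
    have hv : φ.Realize v := by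
      by_contra hc
      have := hiso v φ.not (by simpa using hc) w hvw
      simp at this
      exact this hw
    have hv' : v ∈ {v | φ'.Realize v} ∩ F := h ▸ ⟨hv, hvF⟩
    exact hiso v φ' hv'.1 w hvw
  intro E hE E' hE' h
  exact Subset.antisymm (key _ _ hE hE' h) (key _ _ hE' hE h.symm)

end RyllNardzewski

/-! ### Bounded exponent -/

section Bounded

theorem card_groupLang : groupLang.card ≤ ℵ₀ := by
  have : ∀ n, Countable (GroupFunc n) := by
    intro n
    refine Function.Injective.countable (f := fun x : GroupFunc n => match x with
      | .zero => (0 : ℕ) | .neg => 1 | .add => 2) ?_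
    intro a b h
    cases a <;> cases b <;> simp_all
  have h1 : Countable (Σ n, groupLang.Functions n) :=
    inferInstanceAs (Countable (Σ n, GroupFunc n))
  have h2 : Countable (Σ n, groupLang.Relations n) :=
    inferInstanceAs (Countable (Σ n : ℕ, Empty))
  have : Countable groupLang.Symbols := inferInstanceAs (Countable (_ ⊕ _))
  exact mk_le_aleph0

/-- The term `k • x i`. -/
def nsmulTerm {α : Type} (i : α) : ℕ → groupLang.Term α
  | 0 => Term.func (GroupFunc.zero : groupLang.Functions 0) Fin.elim0
  | k + 1 => Term.func (GroupFunc.add : groupLang.Functions 2) ![nsmulTerm i k, Term.var i]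

theorem realize_nsmulTerm {α : Type} {G : Type*} [AddCommGroup G] (i : α) (k : ℕ) (v : α → G) :
    (nsmulTerm i k).realize v = k • v i := by
  induction k with
  | zero =>
    rw [zero_smul]
    rfl
  | succ k ih =>
    rw [succ_nsmul, ← ih]
    rfl

theorem exists_nsmul_eq_zero_of_categorical_type {G : Type} [AddCommGroup G] [Countable G]
    [Infinite G] (hcat : IsOmegaCategorical groupLang G) : ∃ n : ℕ, 0 < n ∧ ∀ x : G, n • x = 0 := by
  let E : ℕ → Set (Fin 2 → G) := fun k => {v | k • v 0 = v 1}
  have hE : ∀ k, (∅ : Set G).Definable groupLang (E k) := fun k =>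
    Set.empty_definable_iff.2 ⟨(nsmulTerm 0 k).equal (Term.var 1), by
      ext v; simp [E, realize_nsmulTerm]⟩
  obtain ⟨k, -, l, -, hkl, h⟩ := Set.infinite_univ.exists_ne_map_eq_of_mapsTo
    (f := E) (fun k _ => hE k) (finite_definable_of_categorical card_groupLang hcat)
  wlog hlt : k < l generalizing k l
  · exact this l k hkl.symm h.symm (by omega)
  refine ⟨l - k, by omega, fun x => ?_⟩
  have h1 : ![x, k • x] ∈ E k := by simp [E]
  rw [h] at h1
  have h2 : l • x = k • x := by simpa [E] using h1
  rw [sub_nsmul x hlt.le, h2, add_neg_cancel]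

/-- An `ω`-categorical countable abelian group has bounded exponent. -/
theorem exists_nsmul_eq_zero_of_categorical {G : Type*} [AddCommGroup G] [Countable G]
    (hcat : IsOmegaCategorical groupLang G) : ∃ n : ℕ, 0 < n ∧ ∀ x : G, n • x = 0 := by
  cases finite_or_infinite G with
  | inl h => exact ⟨Nat.card G, Nat.card_pos, fun x => card_nsmul_eq_zero'⟩
  | inr h =>
    -- Categoricity speaks of models in `Type`, so `G` is replaced by a copy there.
    let e : Shrink.{0} G ≃+ G := Shrink.addEquiv
    let e' : G ≃[groupLang] Shrink.{0} G :=
      { toEquiv := e.symm.toEquiv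
        map_fun' := by
          rintro n (_ | _ | _) x
          · exact map_zero e.symm
          · exact map_neg e.symm _
          · exact map_add e.symm _ _
        map_rel' := by rintro n ⟨⟩ }
    have hT : groupLang.completeTheory G = groupLang.completeTheory (Shrink.{0} G) :=
      StrongHomClass.elementarilyEquivalent e'
    have : Infinite (Shrink.{0} G) := Infinite.of_injective _ e.symm.injective
    have : Countable (Shrink.{0} G) := e.injective.countable
    obtain ⟨n, hn, h⟩ := exists_nsmul_eq_zero_of_categorical_type (G := Shrink.{0} G) (by
      unfold IsOmegaCategorical at hcat ⊢
      rwa [← hT])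
    refine ⟨n, hn, fun x => ?_⟩
    apply e.symm.injective
    rw [map_nsmul, h, map_zero]

end Bounded
end PseudoSiggers

namespace PseudoSiggers

open Set

/-! ### Consequences of the pseudo-Siggers identity -/

section Polymorphism

/-- On a finite abelian group with at least two nonzero elements, a homomorphism of arity six that
preserves `≠` depends on a single coordinate, so it satisfies no pseudo-Siggers identity. -/
theorem eq_of_ne_zero_of_siggers {F : Type*} [AddCommGroup F] [Finite F] (S : (Fin 6 → F) →+ F)
    (hS : ∀ a, (∀ i, a i ≠ 0) → S a ≠ 0) (e₁ e₂ : F → F) (he : Function.Injective e₁)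
    (h₁ : e₁ 0 = 0) (h₂ : e₂ 0 = 0)
    (hid : ∀ x y z : F, e₁ (S ![x, y, x, z, y, z]) = e₂ (S ![y, x, z, x, z, y])) {x y : F}
    (hx : x ≠ 0) (hy : y ≠ 0) : x = y := by
  by_contra hxy
  have hsum : ∀ c, S c = ∑ i, S (Pi.single i (c i)) := fun c => by
    rw [← map_sum, Finset.univ_sum_single]
  -- Otherwise nonzero kernel elements, one per coordinate, form a tuple without zero entries that
  -- `S` sends to `0`.
  obtain ⟨j, hj⟩ : ∃ j, ∀ c, S (Pi.single j c) = 0 → c = 0 := by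
    by_contra! hcon
    choose c hc hc' using hcon
    exact hS c hc' (by rw [hsum]; exact Finset.sum_eq_zero fun i _ => hc i)
  have hinj : Function.Injective (S.comp (AddMonoidHom.single (fun _ : Fin 6 => F) j)) :=
    (injective_iff_map_eq_zero _).2 hj
  have hsurj := Finite.surjective_of_injective hinj
  -- By surjectivity in coordinate `j`, a nonzero value could be cancelled by a nonzero entry `t`,
  -- contradicting `hS`.
  have hzero : ∀ c : Fin 6 → F, (∀ i, i ≠ j → c i ≠ 0) → S (Function.update c j 0) = 0 := by
    intro c hc
    by_contra hne
    obtain ⟨t, ht⟩ := hsurj (-S (Function.update c j 0))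
    have ht' : S (Pi.single j t) = -S (Function.update c j 0) := ht
    have ht0 : t ≠ 0 := by
      rintro rfl
      rw [Pi.single_zero, map_zero] at ht'
      exact hne (neg_eq_zero.1 ht'.symm)
    refine hS (Function.update c j 0 + Pi.single j t) (fun i => ?_) ?_
    · by_cases hi : i = j
      · subst hi; simpa using ht0
      · simpa [hi] using hc i hi
    · rw [map_add, ht', add_neg_cancel]
  have hother : ∀ i, i ≠ j → ∀ z, S (Pi.single i z) = 0 := by
    intro i hi z
    -- As `x ≠ y`, one of them serves as `w`; thus `z` is a difference of nonzero elements, to both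
    -- of which `hzero` applies.
    obtain ⟨w, hw, hzw⟩ : ∃ w, w ≠ 0 ∧ z + w ≠ 0 := by
      by_cases h : z + x = 0
      · refine ⟨y, hy, fun h' => hxy ?_⟩
        exact add_left_cancel (h.trans h'.symm)
      · exact ⟨x, hx, h⟩
    have key : ∀ u : F, u ≠ 0 →
        S (Function.update (Function.update (fun _ => x) i u) j 0) = 0 := by
      intro u hu
      refine hzero _ fun l _ => ?_
      by_cases hl : l = i
      · subst hl; simpa using hu
      · simpa [hl] using hx
    have hdiff : (Pi.single i z : Fin 6 → F) =
        Function.update (Function.update (fun _ => x) i (z + w)) j 0 -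
          Function.update (Function.update (fun _ => x) i w) j 0 := by
      ext l
      by_cases hlj : l = j
      · subst hlj; simp [hi.symm]
      · by_cases hl : l = i
        · subst hl; simp [hlj]
        · simp [hlj, hl]
    rw [hdiff, map_sub, key _ hzw, key _ hw, sub_zero]
  have hone : ∀ a, S a = S (Pi.single j (a j)) := fun a => by
    rw [hsum, Finset.sum_eq_single j (fun i _ hi => hother i hi _) (by simp)]
  have hfin : ∀ a b : Fin 6 → F, a j = x → b j = 0 → e₁ (S a) ≠ e₂ (S b) := by
    intro a b ha hb h
    rw [hone a, hone b, ha, hb, Pi.single_zero, map_zero, h₂, ← h₁] at h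
    exact hx (hj x (he h))
  -- In each case the variable at position `j` on the left is set to `x` and the others to `0`.
  fin_cases j
  · exact hfin _ _ rfl rfl (hid x 0 0)
  · exact hfin _ _ rfl rfl (hid 0 x 0)
  · exact hfin _ _ rfl rfl (hid x 0 0)
  · exact hfin _ _ rfl rfl (hid 0 0 x)
  · exact hfin _ _ rfl rfl (hid 0 x 0)
  · exact hfin _ _ rfl rfl (hid 0 0 x)

/-- For an abelian group with a pseudo-Siggers polymorphism that preserves `≠`, every finite
subgroup of the form `m • G` has at most one nonzero element. -/
theorem nsmul_eq_nsmul_of_hasPseudoSiggers {G : Type*} [AddCommGroup G]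
    (hs : HasPseudoSiggers (groupLang.sum neqLang) G) {m : ℕ}
    (hm : (range fun x : G => m • x).Finite) {x y : G} (hx : m • x ≠ 0) (hy : m • y ≠ 0) :
    m • x = m • y := by
  obtain ⟨s, hpol, e₁, e₂, hid⟩ := hs
  have hadd : ∀ a b, s (a + b) = s a + s b := fun a b =>
    hpol.map_fun (Sum.inl GroupFunc.add : (groupLang.sum neqLang).Functions 2) ![a, b]
  have hne : ∀ a b : Fin 6 → G, (∀ i, a i ≠ b i) → s a ≠ s b := fun a b h =>
    hpol.map_rel (Sum.inr NeqRel.neq : (groupLang.sum neqLang).Relations 2) ![a, b] h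
  have headd : ∀ (e : G →[groupLang.sum neqLang] G) a b, e (a + b) = e a + e b := fun e a b =>
    e.map_fun (Sum.inl GroupFunc.add : (groupLang.sum neqLang).Functions 2) ![a, b]
  have hene : ∀ (e : G →[groupLang.sum neqLang] G) a b, a ≠ b → e a ≠ e b := fun e a b h =>
    e.map_rel (Sum.inr NeqRel.neq : (groupLang.sum neqLang).Relations 2) ![a, b] h
  let S : (Fin 6 → G) →+ G := AddMonoidHom.mk' s hadd
  let E : (G →[groupLang.sum neqLang] G) → (G →+ G) := fun e => AddMonoidHom.mk' e (headd e)
  let F : AddSubgroup G := (nsmulAddMonoidHom m : G →+ G).range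
  have hF : Finite F := hm
  have hSF : ∀ a : Fin 6 → F, S (fun i => (a i : G)) ∈ F := by
    intro a
    choose b hb using fun i => (a i).2
    refine ⟨S b, ?_⟩
    rw [nsmulAddMonoidHom_apply, ← map_nsmul]
    exact congrArg S (funext hb)
  have hEF : ∀ e (a : F), E e a ∈ F := by
    rintro e ⟨_, b, rfl⟩
    exact ⟨E e b, (map_nsmul (E e) m b).symm⟩
  let S' : (Fin 6 → F) →+ F := AddMonoidHom.mk' (fun a => ⟨S fun i => (a i : G), hSF a⟩)
    fun a b => Subtype.ext (map_add S (fun i => (a i : G)) fun i => (b i : G))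
  have hvec : ∀ a b c d u v : F, (fun i => ((![a, b, c, d, u, v] : Fin 6 → F) i : G)) =
      ![(a : G), b, c, d, u, v] := by
    intro a b c d u v
    ext i; fin_cases i <;> rfl
  have := eq_of_ne_zero_of_siggers S'
    (fun a ha h => hne (fun i => (a i : G)) 0 (fun i hi => ha i (Subtype.ext hi))
      ((congrArg Subtype.val h).trans (map_zero S).symm))
    (fun a => ⟨E e₁ a, hEF e₁ a⟩) (fun a => ⟨E e₂ a, hEF e₂ a⟩)
    (fun a b h => by
      by_contra hab
      exact hene e₁ a b (fun h' => hab (Subtype.ext h')) (congrArg Subtype.val h))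
    (Subtype.ext (map_zero (E e₁))) (Subtype.ext (map_zero (E e₂)))
    (fun a b c => Subtype.ext (by
      change e₁ (s fun i => ((![a, b, a, c, b, c] : Fin 6 → F) i : G)) =
        e₂ (s fun i => ((![b, a, c, a, c, b] : Fin 6 → F) i : G))
      rw [hvec, hvec]
      exact hid a b c))
    (x := ⟨m • x, x, rfl⟩) (y := ⟨m • y, y, rfl⟩)
    (fun h => hx (congrArg Subtype.val h)) (fun h => hy (congrArg Subtype.val h))
  exact congrArg Subtype.val this

end Polymorphism

/-! ### Embeddings into and from sums of cyclic groups -/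

section Embeddings

theorem zmodLift_zmultiplesHom_injective {A : Type*} [AddCommGroup A] {m : ℕ} {a : A}
    (h : zmultiplesHom A a (m : ℤ) = 0) (ha : addOrderOf a = m) :
    Function.Injective (ZMod.lift m ⟨zmultiplesHom A a, h⟩) := by
  rw [ZMod.lift_injective]
  intro k hk
  rw [ZMod.intCast_zmod_eq_zero_iff_dvd, ← ha]
  exact addOrderOf_dvd_iff_zsmul_eq_zero.2 hk

/-- Homomorphisms to `ZMod m` separate the points of an abelian group annihilated by `m`. -/
theorem exists_hom_zmod_apply_ne_zero {A : Type*} [AddCommGroup A] {m : ℕ} (hm : 0 < m)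
    (h : ∀ x : A, m • x = 0) {a : A} (ha : a ≠ 0) : ∃ χ : A →+ ZMod m, χ a ≠ 0 := by
  obtain ⟨c, hc⟩ := CharacterModule.exists_character_apply_ne_zero_of_ne_zero ha
  have hm' : (m : ℚ) ≠ 0 := by positivity
  let t : AddCircle (1 : ℚ) := ((1 / m : ℚ) : AddCircle (1 : ℚ))
  have ht : addOrderOf t = m := AddCircle.addOrderOf_period_div hm
  have ht0 : zmultiplesHom _ t (m : ℤ) = 0 := by
    have := addOrderOf_nsmul_eq_zero t
    rw [ht] at this
    simpa using this
  -- `T` identifies `ZMod m` with the `m`-torsion of `ℚ/ℤ`, where all values of `c` lie.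
  let T : ZMod m →+ AddCircle (1 : ℚ) := ZMod.lift m ⟨zmultiplesHom _ t, ht0⟩
  have hT : Function.Injective T := zmodLift_zmultiplesHom_injective ht0 ht
  let c' : A →+ AddCircle (1 : ℚ) := c
  have hrange : ∀ x, c' x ∈ T.range := by
    intro x
    have hx : m • c' x = 0 := by rw [← map_nsmul, h, map_zero]
    obtain ⟨k, -, hk⟩ := (AddCircle.nsmul_eq_zero_iff hm).1 hx
    refine ⟨(k : ℤ), ?_⟩
    rw [ZMod.lift_coe, ← hk]
    change (k : ℤ) • t = _
    rw [natCast_zsmul, ← AddCircle.coe_nsmul]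
    congr 1
    simp [div_eq_mul_inv]
  refine ⟨(AddMonoidHom.ofInjective hT).symm.toAddMonoidHom.comp (c'.codRestrict T.range hrange),
    fun h0 => hc ?_⟩
  have h1 : c'.codRestrict T.range hrange a = 0 :=
    (AddMonoidHom.ofInjective hT).symm.injective (h0.trans (map_zero _).symm)
  exact congrArg Subtype.val h1

/-- `A` is a union of a chain of finite subgroups `B n`. For each `x ≠ 0` take a character that is
nonzero at `x` but kills every `B n` not containing `x`. An element of `B n` is then detected only
by characters indexed by `B n`, whence finite support. -/
theorem exists_injective_finsupp_zmod {A : Type*} [AddCommGroup A] [Countable A] {m : ℕ}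
    (hm : 0 < m) (h : ∀ x : A, m • x = 0) :
    ∃ f : A →+ (ℕ →₀ ZMod m), Function.Injective f := by
  classical
  obtain ⟨g, hg⟩ := exists_surjective_nat A
  let B : ℕ → AddSubgroup A := fun n => AddSubgroup.closure (g '' Iio n)
  have hBmono : Monotone B := fun i j hij =>
    AddSubgroup.closure_mono (image_mono (Iio_subset_Iio hij))
  have hBfin : ∀ n, (B n : Set A).Finite := by
    intro n
    have : AddGroup.FG (B n) := by
      rw [AddGroup.fg_iff_addSubgroup_fg]
      exact AddSubgroup.fg_iff _ |>.2 ⟨_, rfl, (finite_Iio n).image g⟩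
    have htor : IsAddTorsion (B n) := fun x =>
      isOfFinAddOrder_iff_nsmul_eq_zero.2 ⟨m, hm, Subtype.ext (h x)⟩
    exact AddCommGroup.finite_of_fg_isAddTorsion (B n) htor
  have hBex : ∀ x, ∃ n, x ∈ B n := by
    intro x
    obtain ⟨n, rfl⟩ := hg x
    exact ⟨n + 1, AddSubgroup.subset_closure ⟨n, by simp, rfl⟩⟩
  have hχ : ∀ x : A, ∃ χ : A →+ ZMod m, (x ≠ 0 → χ x ≠ 0) ∧
      ∀ n, x ∉ B n → ∀ y ∈ B n, χ y = 0 := by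
    intro x
    by_cases hx : x = 0
    · exact ⟨0, fun h => absurd hx h, fun _ _ _ _ => rfl⟩
    let k := Nat.find (hBex x)
    have hk0 : k ≠ 0 := by
      intro hk
      have : x ∈ B k := Nat.find_spec (hBex x)
      simp [hk, B] at this
      exact hx this
    have hxk : x ∉ B (k - 1) := Nat.find_min (hBex x) (by omega)
    obtain ⟨χ, hχ⟩ := exists_hom_zmod_apply_ne_zero (A := A ⧸ B (k - 1)) hm
      (fun y => by
        obtain ⟨y, rfl⟩ := QuotientAddGroup.mk_surjective y
        rw [← QuotientAddGroup.mk_nsmul, h]; rfl)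
      (a := (x : A ⧸ B (k - 1))) (by rwa [Ne, QuotientAddGroup.eq_zero_iff])
    refine ⟨χ.comp (QuotientAddGroup.mk' _), fun _ => hχ, fun n hn y hy => ?_⟩
    have hnk : n ≤ k - 1 := by
      by_contra hlt
      exact hn (hBmono (by omega : k ≤ n) (Nat.find_spec (hBex x)))
    have : (y : A ⧸ B (k - 1)) = 0 := (QuotientAddGroup.eq_zero_iff _).2 (hBmono hnk hy)
    change χ (y : A ⧸ B (k - 1)) = 0
    rw [this, map_zero]
  choose χ hχ1 hχ2 using hχ
  have hsupp : ∀ y, (Function.support fun x => χ x y).Finite := by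
    intro y
    obtain ⟨n, hn⟩ := hBex y
    refine (hBfin n).subset fun x hx => ?_
    by_contra hxn
    exact hx (hχ2 x n hxn y hn)
  let f : A →+ (A →₀ ZMod m) := AddMonoidHom.mk' (fun y => Finsupp.ofSupportFinite _ (hsupp y))
    fun y z => by ext x; exact map_add (χ x) y z
  have hf : Function.Injective f := by
    refine (injective_iff_map_eq_zero _).2 fun y hy => ?_
    by_contra hy0
    exact hχ1 y hy0 (DFunLike.congr_fun hy y)
  obtain ⟨i, hi⟩ := exists_injective_nat A
  exact ⟨(Finsupp.mapDomain.addMonoidHom i).comp f, (Finsupp.mapDomain_injective hi).comp hf⟩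

variable {G : Type*} [AddCommGroup G] {m : ℕ}

theorem exists_injective_finsupp_zmod_prod [Countable G] (hm : 0 < m)
    {f : G} (hf : f ≠ 0) (hmf : ∀ x : G, m • x = 0 ∨ m • x = f) (h : ∀ x : G, (2 * m) • x = 0) :
    ∃ φ : G →+ (ℕ →₀ ZMod m) × ZMod (2 * m), Function.Injective φ := by
  obtain ⟨χ, hχ⟩ := exists_hom_zmod_apply_ne_zero (by omega) h hf
  let F : AddSubgroup G := (nsmulAddMonoidHom m : G →+ G).range
  have : Countable (G ⧸ F) := (QuotientAddGroup.mk_surjective (s := F)).countable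
  obtain ⟨ψ, hψ⟩ := exists_injective_finsupp_zmod (A := G ⧸ F) hm (fun y => by
    obtain ⟨y, rfl⟩ := QuotientAddGroup.mk_surjective y
    rw [← QuotientAddGroup.mk_nsmul, QuotientAddGroup.eq_zero_iff]
    exact ⟨y, rfl⟩)
  refine ⟨(ψ.comp (QuotientAddGroup.mk' F)).prod χ, (injective_iff_map_eq_zero _).2 fun y hy => ?_⟩
  have h1 : ψ (y : G ⧸ F) = 0 := congrArg Prod.fst hy
  have h2 : χ y = 0 := congrArg Prod.snd hy
  have h3 : (y : G ⧸ F) = 0 := hψ (h1.trans (map_zero ψ).symm)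
  obtain ⟨z, rfl⟩ := (QuotientAddGroup.eq_zero_iff _).1 h3
  rcases hmf z with h4 | h4
  · exact h4
  · exact absurd (h4 ▸ h2) hχ

/-- If `m` generates the ideal of all `k` with `k • G` finite, then modulo any finite subgroup
there is an element of order `m` that is annihilated by `m`. -/
theorem exists_nsmul_mem_imp_dvd (hm : 0 < m) (hfin : (range fun x : G => m • x).Finite)
    (hdvd : ∀ k : ℕ, (range fun x : G => k • x).Finite → m ∣ k) (H : AddSubgroup G) [Finite H] :
    ∃ g : G, m • g = 0 ∧ ∀ k : ℕ, k • g ∈ H → m ∣ k := by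
  let K : AddSubgroup G := (nsmulAddMonoidHom m : G →+ G).ker
  have hK : ∀ x, x ∈ K ↔ m • x = 0 := fun x => AddMonoidHom.mem_ker
  let Q := K ⧸ H.addSubgroupOf K
  have hQ : AddMonoid.ExponentExists Q := ⟨m, hm, fun q => by
    obtain ⟨x, rfl⟩ := QuotientAddGroup.mk_surjective q
    rw [← QuotientAddGroup.mk_nsmul, show m • x = 0 from Subtype.ext ((hK _).1 x.2)]
    rfl⟩
  obtain ⟨q, hq⟩ := AddMonoid.exists_addOrderOf_eq_exponent hQ
  obtain ⟨g, rfl⟩ := QuotientAddGroup.mk_surjective q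
  set e := AddMonoid.exponent Q
  have heH : ∀ x ∈ K, e • x ∈ H := by
    intro x hx
    have := AddMonoid.exponent_nsmul_eq_zero (((⟨x, hx⟩ : K)) : Q)
    rw [← QuotientAddGroup.mk_nsmul, QuotientAddGroup.eq_zero_iff,
      AddSubgroup.mem_addSubgroupOf] at this
    exact this
  -- With `r` a section of multiplication by `m`, each `x` is `r (m • x)` plus an element of `K`.
  -- Since `e • K ⊆ H`, the set `e • G` lies in a sum of two finite sets.
  have he : m ∣ e := by
    refine hdvd e ?_
    let r : G → G := Function.invFun fun x : G => m • x
    refine ((hfin.image fun y => e • r y).image2 (· + ·) (Set.toFinite (H : Set G))).subset ?_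
    rintro _ ⟨x, rfl⟩
    refine ⟨e • r (m • x), ⟨m • x, ⟨x, rfl⟩, rfl⟩, e • (x - r (m • x)), ?_, ?_⟩
    · refine heH _ ((hK _).2 ?_)
      have : m • r (m • x) = m • x := Function.invFun_eq (f := fun x : G => m • x) ⟨x, rfl⟩
      rw [nsmul_sub, this, sub_self]
    · simp [nsmul_sub]
  refine ⟨g, (hK _).1 g.2, fun k hk => he.trans ?_⟩
  rw [← hq, addOrderOf_dvd_iff_nsmul_eq_zero, ← QuotientAddGroup.mk_nsmul,
    QuotientAddGroup.eq_zero_iff, AddSubgroup.mem_addSubgroupOf]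
  exact hk

/-- Under the same assumptions, the group contains a direct sum of countably many copies of `ZMod m`
that is independent of a given finite subgroup. -/
theorem exists_hom_finsupp_zmod_of_mem (hm : 0 < m) (hfin : (range fun x : G => m • x).Finite)
    (hdvd : ∀ k : ℕ, (range fun x : G => k • x).Finite → m ∣ k) (K : AddSubgroup G) [Finite K] :
    ∃ Φ : (ℕ →₀ ZMod m) →+ G, ∀ x, Φ x ∈ K → x = 0 := by
  classical
  have : NeZero m := ⟨hm.ne'⟩
  choose nx hnx1 hnx2 using fun H : {H : AddSubgroup G // Finite H} =>
    have := H.2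
    exists_nsmul_mem_imp_dvd hm hfin hdvd H.1
  have hsup : ∀ H : {H : AddSubgroup G // Finite H},
      Finite (H.1 ⊔ AddSubgroup.zmultiples (nx H) : AddSubgroup G) := by
    intro H
    have h1 : (H.1 : Set G).Finite := H.2
    have h2 : (AddSubgroup.zmultiples (nx H) : Set G).Finite :=
      finite_zmultiples.2 (isOfFinAddOrder_iff_nsmul_eq_zero.2 ⟨m, hm, hnx1 H⟩)
    have h3 := h1.add h2
    rw [← AddSubgroup.add_normal] at h3
    exact h3
  let H : ℕ → {H : AddSubgroup G // Finite H} := fun n =>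
    Nat.rec ⟨K, inferInstance⟩ (fun _ H => ⟨H.1 ⊔ AddSubgroup.zmultiples (nx H), hsup H⟩) n
  let g : ℕ → G := fun n => nx (H n)
  have hmono : Monotone fun n => (H n).1 := monotone_nat_of_le_succ fun n => le_sup_left
  have hg : ∀ n, g n ∈ (H (n + 1)).1 := fun n =>
    (le_sup_right : _ ≤ (H n).1 ⊔ _) (AddSubgroup.mem_zmultiples _)
  let Φ : (ℕ →₀ ZMod m) →+ G := Finsupp.liftAddHom fun n =>
    ZMod.lift m ⟨zmultiplesHom G (g n), by simpa using hnx1 (H n)⟩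
  have hΦ : ∀ x, Φ x = ∑ n ∈ x.support, (x n).val • g n := by
    intro x
    rw [Finsupp.liftAddHom_apply, Finsupp.sum]
    refine Finset.sum_congr rfl fun n _ => ?_
    have h1 : x n = (((x n).val : ℤ) : ZMod m) := by simp
    conv_lhs => rw [h1]
    rw [ZMod.lift_coe]
    exact natCast_zsmul _ _
  refine ⟨Φ, fun x hx => ?_⟩
  by_contra hx0
  have hne : x.support.Nonempty := Finsupp.support_nonempty_iff.2 hx0
  -- All terms of `Φ x` but the top one lie in `H n`, hence so does the top one, and the choice of
  -- `g n` makes its coefficient vanish.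
  set n := x.support.max' hne
  have hn : n ∈ x.support := Finset.max'_mem _ _
  have hrest : ∑ i ∈ x.support.erase n, (x i).val • g i ∈ (H n).1 := by
    refine AddSubgroup.sum_mem _ fun i hi => AddSubgroup.nsmul_mem _ ?_ _
    have hin : i + 1 ≤ n := lt_of_le_of_ne
      (Finset.le_max' _ _ (Finset.mem_of_mem_erase hi)) (Finset.ne_of_mem_erase hi)
    exact hmono hin (hg i)
  have hmem : (x n).val • g n ∈ (H n).1 := by
    have h1 := hmono (Nat.zero_le n) hx
    rw [hΦ, ← Finset.add_sum_erase _ _ hn] at h1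
    exact (AddSubgroup.add_mem_cancel_right _ hrest).1 h1
  have h2 := hnx2 (H n) _ hmem
  have h3 : (x n).val = 0 := Nat.eq_zero_of_dvd_of_lt h2 (ZMod.val_lt _)
  exact (Finsupp.mem_support_iff.1 hn) ((ZMod.val_eq_zero _).1 h3)

theorem biEmbeddable_finsupp_zmod [Countable G] (hm : 0 < m) (h : ∀ x : G, m • x = 0)
    (hdvd : ∀ k : ℕ, (range fun x : G => k • x).Finite → m ∣ k) :
    BiEmbeddable G (ℕ →₀ ZMod m) := by
  refine ⟨exists_injective_finsupp_zmod hm h, ?_⟩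
  obtain ⟨Φ, hΦ⟩ := exists_hom_finsupp_zmod_of_mem hm
    ((finite_singleton (0 : G)).subset (by rintro _ ⟨x, rfl⟩; exact h x)) hdvd ⊥
  exact ⟨Φ, (injective_iff_map_eq_zero _).2 fun x hx => hΦ x (by simp [hx])⟩

theorem biEmbeddable_finsupp_zmod_prod [Countable G] (hm : 0 < m)
    {f : G} (hf : f ≠ 0) (hmf : ∀ x : G, m • x = 0 ∨ m • x = f) (h : ∀ x : G, (2 * m) • x = 0)
    (hex : ∃ x : G, m • x = f)
    (hdvd : ∀ k : ℕ, (range fun x : G => k • x).Finite → m ∣ k) :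
    BiEmbeddable G ((ℕ →₀ ZMod m) × ZMod (2 * m)) := by
  refine ⟨exists_injective_finsupp_zmod_prod hm hf hmf h, ?_⟩
  have hG : AddMonoid.ExponentExists G := ⟨2 * m, by omega, h⟩
  -- The exponent is a multiple of `m` dividing `2 * m`, and it is not `m` because `f ≠ 0`.
  have hexp : AddMonoid.exponent G = 2 * m := by
    obtain ⟨c, hc⟩ := hdvd (AddMonoid.exponent G) ((finite_singleton (0 : G)).subset (by
      rintro _ ⟨x, rfl⟩; exact AddMonoid.exponent_nsmul_eq_zero x))
    have h2 : AddMonoid.exponent G ∣ 2 * m := AddMonoid.exponent_dvd_of_forall_nsmul_eq_zero h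
    rw [hc, mul_comm 2 m] at h2
    have h3 : c ∣ 2 := Nat.dvd_of_mul_dvd_mul_left hm h2
    rcases (Nat.dvd_prime Nat.prime_two).1 h3 with rfl | rfl
    · obtain ⟨x, hx⟩ := hex
      have := AddMonoid.exponent_nsmul_eq_zero x
      rw [hc, mul_one, hx] at this
      exact absurd this hf
    · rw [hc, mul_comm]
  obtain ⟨y, hy⟩ := AddMonoid.exists_addOrderOf_eq_exponent hG
  rw [hexp] at hy
  have : Finite (AddSubgroup.zmultiples y) :=
    finite_zmultiples.2 (addOrderOf_pos_iff.1 (by omega))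
  obtain ⟨Φ, hΦ⟩ := exists_hom_finsupp_zmod_of_mem hm
    ((toFinite {0, f}).subset (by rintro _ ⟨x, rfl⟩; exact hmf x)) hdvd
    (AddSubgroup.zmultiples y)
  have hy0 : zmultiplesHom G y ((2 * m : ℕ) : ℤ) = 0 := by
    rw [zmultiplesHom_apply, natCast_zsmul]; exact h y
  have hinj := zmodLift_zmultiplesHom_injective hy0 hy
  set Y : ZMod (2 * m) →+ G := ZMod.lift (2 * m) ⟨zmultiplesHom G y, hy0⟩
  have hY : ∀ c, Y c ∈ AddSubgroup.zmultiples y := by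
    intro c
    obtain ⟨k, rfl⟩ := ZMod.intCast_surjective c
    rw [ZMod.lift_coe]
    exact ⟨k, rfl⟩
  refine ⟨Φ.coprod Y, (injective_iff_map_eq_zero _).2 ?_⟩
  rintro ⟨x, c⟩ hxc
  rw [AddMonoidHom.coprod_apply] at hxc
  have hx : x = 0 := hΦ x (by
    rw [eq_neg_of_add_eq_zero_left hxc]
    exact AddSubgroup.neg_mem _ (hY c))
  subst hx
  rw [map_zero, zero_add] at hxc
  rw [(injective_iff_map_eq_zero _).1 hinj c hxc]
  rfl

/-- The numbers `k` with `k • G` finite are the multiples of the least positive one. -/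
theorem exists_finite_range_nsmul_iff_dvd {n : ℕ} (hn : 0 < n) (h : ∀ x : G, n • x = 0) :
    ∃ m : ℕ, 0 < m ∧ (range fun x : G => m • x).Finite ∧
      ∀ k : ℕ, (range fun x : G => k • x).Finite → m ∣ k := by
  classical
  have hex : ∃ m : ℕ, 0 < m ∧ (range fun x : G => m • x).Finite :=
    ⟨n, hn, (finite_singleton (0 : G)).subset (by rintro _ ⟨x, rfl⟩; exact h x)⟩
  obtain ⟨hm, hfin⟩ := Nat.find_spec hex
  refine ⟨Nat.find hex, hm, hfin, fun k hk => Nat.dvd_of_mod_eq_zero ?_⟩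
  by_contra hmod
  refine Nat.find_min hex (Nat.mod_lt k hm) ⟨Nat.pos_of_ne_zero hmod, ?_⟩
  refine (hk.image2 (· - ·) hfin).subset ?_
  rintro _ ⟨x, rfl⟩
  -- Division with remainder: `(k % m) • x = k • x - m • ((k / m) • x)`.
  refine ⟨k • x, ⟨x, rfl⟩, Nat.find hex • ((k / Nat.find hex) • x), ⟨_, rfl⟩, ?_⟩
  rw [← mul_nsmul', sub_eq_iff_eq_add]
  change k • x = _ • x + _ • x
  rw [← add_nsmul, Nat.mod_add_div]

end Embeddings
end PseudoSiggers

theorem mainTheorem6 {G : Type*} [AddCommGroup G] [Countable G]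
    (hcat : PseudoSiggers.IsOmegaCategorical PseudoSiggers.groupLang G)
    (hs : PseudoSiggers.HasPseudoSiggers
      (PseudoSiggers.groupLang.sum PseudoSiggers.neqLang) G) :
    ∃ m : ℕ, 1 ≤ m ∧
      (PseudoSiggers.BiEmbeddable G (ℕ →₀ ZMod m) ∨
        PseudoSiggers.BiEmbeddable G ((ℕ →₀ ZMod m) × ZMod (2 * m))) := by
  obtain ⟨n, hn, h⟩ := PseudoSiggers.exists_nsmul_eq_zero_of_categorical hcat
  obtain ⟨m, hm, hfin, hdvd⟩ := PseudoSiggers.exists_finite_range_nsmul_iff_dvd hn h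
  refine ⟨m, hm, ?_⟩
  by_cases h0 : ∀ x : G, m • x = 0
  · exact Or.inl (PseudoSiggers.biEmbeddable_finsupp_zmod hm h0 hdvd)
  · push Not at h0
    obtain ⟨y, hy⟩ := h0
    have hmf : ∀ x : G, m • x = 0 ∨ m • x = m • y := fun x =>
      or_iff_not_imp_left.2 fun hx =>
        PseudoSiggers.nsmul_eq_nsmul_of_hasPseudoSiggers hs hfin hx hy
    have h2 : ∀ x : G, (2 * m) • x = 0 := by
      intro x
      rw [two_mul, add_nsmul]
      rcases hmf x with h1 | h1
      · rw [h1, add_zero]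
      · rw [h1, ← nsmul_add]
        rcases hmf (y + y) with h3 | h3
        · exact h3
        · rw [nsmul_add, add_eq_left] at h3
          exact absurd h3 hy
    exact Or.inr (PseudoSiggers.biEmbeddable_finsupp_zmod_prod hm hy hmf h2 ⟨y, rfl⟩ hdvd)
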